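/- **Definitions.** Let $L$ be a bounded distributive lattice with a complementary pair $tt,ff$ (that is, $tt\vee ff=1$, $tt\wedge ff=0$), and put $L_+=[0,tt]$, $L_-=[0,ff]$; via $x\mapsto(x\wedge tt,x\wedge ff)$ one identifies $L$ with $L_+\times L_-$, the pair $(a,b)$ corresponding to $a\vee b$. The *logic order* on $L$ is $(a_1,b_1)\sqsubseteq(a_2,b_2)\iff a_1\le a_2$ and $b_1\ge b_2$. A *d-lattice* $(L;tt,ff;\mathrm{con},\mathrm{tot})$ consists of such data and subsets $\mathrm{con},\mathrm{tot}\subseteq L$ such that $tt,ff\in\mathrm{con}\cap\mathrm{tot}$; $\mathrm{con}$ is Scott closed (a lower set closed under existing directed joins) and $\mathrm{tot}$ is an upper set of $(L,\le)$; $\mathrm{con}$ and $\mathrm{tot}$ are sublattices of $(L,\sqsubseteq)$; and for $\alpha\in\mathrm{con}$, $\beta\in\mathrm{tot}$, if $\alpha\wedge tt=\beta\wedge tt$ or $\alpha\wedge ff=\beta\wedge ff$, then $\alpha\le\beta$. A *d-lattice homomorphism* is a lattice homomorphism that preserves $tt$ and $ff$ and maps $\mathrm{con}$ into $\mathrm{con}$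 and $\mathrm{tot}$ into $\mathrm{tot}$. A *d-Boolean algebra* is a d-lattice in which for every $a\in L_+$ there is $b\in L_-$ with $a\vee b\in\mathrm{con}\cap\mathrm{tot}$, and for every $b\in L_-$ there is $a\in L_+$ with $a\vee b\in\mathrm{con}\cap\mathrm{tot}$. It is *complete* if the lattice $L$ is complete, and *nondegenerate* if $\{tt,ff\}\ne\{1,0\}$ (for a d-Boolean algebra: if $0\neq 1$). A *bitopological space* $(X,\tau_+,\tau_-)$ is a set with two topologies; a map is *continuous* if it is continuous for both the $\tau_+$'s and the $\tau_-$'s. It is a *Stone bitopological space* if it is $T_0$ (any two distinct points are separated by a member of $\tau_+\cup\tau_-$ that contains exactly one of them), compact (every cover of $X$ by members of $\tau_+\cup\tau_-$ has a finite subcover) and zero-dimensional ($\tau_+$ has a base of $\tau_-$-closed sets and $\tau_-$ has a base of $\tau_+$-closed sets). It is *extremally disconnected* if the $\tau_-$-closure of every $\tau_+$-open set is $\tau_+$-open and the $\tau_+$-closure of every $\tau_-$-open set is $\tau_-$-open. **Theorem.** The category of complete d-Boolean algebras (the one-element algebra included) and d-lattice homomorphisms is dually equivalent to the category of extremally disconnected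 Stone bitopological spaces (the empty space included) and continuous maps. Likewise, the category of nondegenerate complete d-Boolean algebras and d-lattice homomorphisms is dually equivalent to the category of nonempty extremally disconnected Stone bitopological spaces and continuous maps. -/

import Mathlib

open CategoryTheory Topology

universe u

namespace DBoolean

/-! ### d-lattices -/

/-- A d-lattice `(L; tt, ff; con, tot)`.  A pair `(a, b)` of elements of `L₊ = [0, tt]` and
`L₋ = [0, ff]` is identified with the element `a ⊔ b` of `L`; the components of `x : L` are
`x ⊓ tt` and `x ⊓ ff`.  The meet and the join of the logic order `x ⊑ y` (that is,
`x ⊓ tt ≤ y ⊓ tt` and `y ⊓ ff ≤ x ⊓ ff`) are given by the ternary formulas in the fields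
`con_logicMeet`, ..., `tot_logicJoin`. -/
structure DLat : Type (u + 1) where
  carrier : Type u
  [distribLattice : DistribLattice carrier]
  [boundedOrder : BoundedOrder carrier]
  tt : carrier
  ff : carrier
  isCompl_tt_ff : IsCompl tt ff
  /-- the consistency predicate -/
  con : Set carrier
  /-- the totality predicate -/
  tot : Set carrier
  tt_mem_con : tt ∈ con
  ff_mem_con : ff ∈ con
  tt_mem_tot : tt ∈ tot
  ff_mem_tot : ff ∈ tot
  /-- `con` is Scott closed: a lower set that is closed under existing directed joins -/
  con_isLowerSet : IsLowerSet con
  con_dirSupClosed : DirSupClosed con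
  tot_isUpperSet : IsUpperSet tot
  con_logicMeet : ∀ x ∈ con, ∀ y ∈ con, (x ⊓ ff) ⊔ (y ⊓ ff) ⊔ (x ⊓ y) ∈ con
  con_logicJoin : ∀ x ∈ con, ∀ y ∈ con, (x ⊓ tt) ⊔ (y ⊓ tt) ⊔ (x ⊓ y) ∈ con
  tot_logicMeet : ∀ x ∈ tot, ∀ y ∈ tot, (x ⊓ ff) ⊔ (y ⊓ ff) ⊔ (x ⊓ y) ∈ tot
  tot_logicJoin : ∀ x ∈ tot, ∀ y ∈ tot, (x ⊓ tt) ⊔ (y ⊓ tt) ⊔ (x ⊓ y) ∈ tot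
  con_tot : ∀ x ∈ con, ∀ y ∈ tot, (x ⊓ tt = y ⊓ tt ∨ x ⊓ ff = y ⊓ ff) → x ≤ y

namespace DLat

instance : CoeSort DLat.{u} (Type u) := ⟨DLat.carrier⟩

instance (L : DLat.{u}) : DistribLattice L := L.distribLattice

instance (L : DLat.{u}) : BoundedOrder L := L.boundedOrder

/-- d-lattice homomorphisms. -/
structure Hom (L M : DLat.{u}) extends LatticeHom L M where
  map_tt : toFun L.tt = M.tt
  map_ff : toFun L.ff = M.ff
  map_con : ∀ x ∈ L.con, toFun x ∈ M.con
  map_tot : ∀ x ∈ L.tot, toFun x ∈ M.tot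

/-- The category of d-lattices and d-lattice homomorphisms. -/
instance : Category DLat.{u} where
  Hom L M := Hom L M
  id L := 
    { LatticeHom.id L with
      map_tt := rfl
      map_ff := rfl
      map_con := fun _ hx => hx
      map_tot := fun _ hx => hx }
  comp f g := 
    { g.toLatticeHom.comp f.toLatticeHom with
      map_tt := (congrArg g.toFun f.map_tt).trans g.map_tt
      map_ff := (congrArg g.toFun f.map_ff).trans g.map_ff
      map_con := fun x hx => g.map_con _ (f.map_con x hx)
      map_tot := fun x hx => g.map_tot _ (f.map_tot x hx) }

/-- `x` is d-complemented: either `x ∈ L₊` and `(x, y) ∈ con ∩ tot` for some `y ∈ L₋`, or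
`x ∈ L₋` and `(y, x) ∈ con ∩ tot` for some `y ∈ L₊`. -/
def IsDComplemented (L : DLat.{u}) (x : L) : Prop :=
  (x ≤ L.tt ∧ ∃ y ≤ L.ff, x ⊔ y ∈ L.con ∩ L.tot) ∨
    (x ≤ L.ff ∧ ∃ y ≤ L.tt, y ⊔ x ∈ L.con ∩ L.tot)

/-- A d-lattice is a d-Boolean algebra if every element of `L₊ ∪ L₋` is d-complemented. -/
def IsDBoolean (L : DLat.{u}) : Prop :=
  ∀ x : L, x ≤ L.tt ∨ x ≤ L.ff → L.IsDComplemented x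

/-- The underlying lattice is complete. -/
def IsComplete (L : DLat.{u}) : Prop :=
  ∀ S : Set L, (∃ a, IsLUB S a) ∧ ∃ b, IsGLB S b

/-- The complementary pair `{tt, ff}` is not the pair `{1, 0}`. -/
def IsNondegenerate (L : DLat.{u}) : Prop :=
  ({L.tt, L.ff} : Set L) ≠ {⊤, ⊥}

end DLat

/-! ### Bitopological spaces -/

/-- A bitopological space: a set with two topologies. -/
structure BiTop : Type (u + 1) where
  carrier : Type u
  plus : TopologicalSpace carrier
  minus : TopologicalSpace carrier

namespace BiTop

instance : CoeSort BiTop.{u} (Type u) := ⟨BiTop.carrier⟩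

/-- Continuous maps of bitopological spaces: continuous for both topologies. -/
structure Hom (X Y : BiTop.{u}) where
  toFun : X → Y
  continuous_plus : Continuous[X.plus, Y.plus] toFun
  continuous_minus : Continuous[X.minus, Y.minus] toFun

/-- The category of bitopological spaces and continuous maps. -/
instance : Category BiTop.{u} where
  Hom X Y := Hom X Y
  id X :=
    { toFun := id
      continuous_plus := @continuous_id _ X.plus
      continuous_minus := @continuous_id _ X.minus }
  comp {X Y Z} f g :=
    { toFun := g.toFun ∘ f.toFun
      continuous_plus := @Continuous.comp _ _ _ X.plus Y.plus Z.plus _ _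
        g.continuous_plus f.continuous_plus
      continuous_minus := @Continuous.comp _ _ _ X.minus Y.minus Z.minus _ _
        g.continuous_minus f.continuous_minus }

/-- Distinct points are distinguished by a `τ₊`-open or a `τ₋`-open set. -/
def IsT0 (X : BiTop.{u}) : Prop :=
  ∀ x y : X, x ≠ y → ∃ U : Set X, (IsOpen[X.plus] U ∨ IsOpen[X.minus] U) ∧
    ((x ∈ U ∧ y ∉ U) ∨ (y ∈ U ∧ x ∉ U))

/-- Every cover by members of `τ₊ ∪ τ₋` has a finite subcover. -/
def IsCompact (X : BiTop.{u}) : Prop :=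
  ∀ C : Set (Set X), (∀ U ∈ C, IsOpen[X.plus] U ∨ IsOpen[X.minus] U) → ⋃₀ C = Set.univ →
    ∃ F ⊆ C, F.Finite ∧ ⋃₀ F = Set.univ

/-- `τ₊` has a base of `τ₋`-closed sets and `τ₋` has a base of `τ₊`-closed sets. -/
def IsZeroDimensional (X : BiTop.{u}) : Prop :=
  (∃ B : Set (Set X), @TopologicalSpace.IsTopologicalBasis X X.plus B ∧ ∀ U ∈ B, IsClosed[X.minus] U) ∧
    (∃ B : Set (Set X), @TopologicalSpace.IsTopologicalBasis X X.minus B ∧ ∀ V ∈ B, IsClosed[X.plus] V)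

/-- Stone bitopological spaces. -/
def IsStone (X : BiTop.{u}) : Prop :=
  X.IsT0 ∧ X.IsCompact ∧ X.IsZeroDimensional

/-- The `τ₋`-closure of each `τ₊`-open set is `τ₊`-open, and the `τ₊`-closure of each
`τ₋`-open set is `τ₋`-open. -/
def IsExtremallyDisconnected (X : BiTop.{u}) : Prop :=
  (∀ U : Set X, IsOpen[X.plus] U → IsOpen[X.plus] (closure[X.minus] U)) ∧
    (∀ V : Set X, IsOpen[X.minus] V → IsOpen[X.minus] (closure[X.plus] V))

end BiTop

/-! ### The categories of the duality (full subcategories) -/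

/-- Complete d-Boolean algebras and d-lattice homomorphisms; the one-element algebra is
included. -/
abbrev CompleteDBool : Type (u + 1) :=
  ObjectProperty.FullSubcategory
    (fun L : DLat.{u} => L.IsDBoolean ∧ L.IsComplete)

/-- Complete d-Boolean algebras with `{tt, ff} ≠ {1, 0}`. -/
abbrev NondegCompleteDBool : Type (u + 1) :=
  ObjectProperty.FullSubcategory
    (fun L : DLat.{u} => L.IsDBoolean ∧ L.IsComplete ∧ L.IsNondegenerate)

/-- Extremally disconnected Stone bitopological spaces and continuous maps; the empty space is
included. -/
abbrev EDBiStone : Type (u + 1) :=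
  ObjectProperty.FullSubcategory
    (fun X : BiTop.{u} => X.IsStone ∧ X.IsExtremallyDisconnected)

/-- Nonempty extremally disconnected Stone bitopological spaces. -/
abbrev NonemptyEDBiStone : Type (u + 1) :=
  ObjectProperty.FullSubcategory
    (fun X : BiTop.{u} => X.IsStone ∧ X.IsExtremallyDisconnected ∧ Nonempty X)

end DBoolean

namespace DBoolean

open OrderDual

/-! ### d-lattices of the form `B × Bᵒᵈ` -/

namespace DLat

/-! A d-Boolean algebra carries no more information than the bounded distributive lattice `L₊`.
Exchanging d-complements gives an antitone involution `n` that fixes `tt` and `ff`, and consistency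
of `x` means `x ≤ n x`, totality `n x ≤ x`. Hence `L` is `L₊ × L₊ᵒᵈ` with `con` and `tot` read off
from the order (`IsDBoolean.nonempty_iso`), and homomorphisms between such products are those of the
lattices (`mapOfLattice_surjective`).

It remains to see that bounded distributive lattices are dual to Stone bitopological spaces. The
functor sends `X` to its `τ₊`-open `τ₋`-closed sets. It is full and faithful because compactness
turns every homomorphism `clp X → Prop` into a point (`IsCompact.exists_point`) and T₀ makes that
point unique. It is essentially surjective because `B` is recovered from its spectrum
(`orderIsoClp`). Completeness of the lattice and extremal disconnectedness correspond, suprema being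
closures of unions. -/

@[ext]
theorem hom_ext {L M : DLat.{u}} {f g : L ⟶ M} (h : ∀ x, f.toLatticeHom x = g.toLatticeHom x) :
    f = g := by
  obtain ⟨⟨⟨f, _⟩, _⟩, _, _, _, _⟩ := f
  obtain ⟨⟨⟨g, _⟩, _⟩, _, _, _, _⟩ := g
  obtain rfl : f = g := funext h
  rfl

/-- An order isomorphism that preserves and reflects all the structure is an isomorphism of
d-lattices. -/
def isoOfOrderIso {L M : DLat.{u}} (e : L ≃o M) (htt : e L.tt = M.tt) (hff : e L.ff = M.ff)
    (hcon : ∀ x, e x ∈ M.con ↔ x ∈ L.con) (htot : ∀ x, e x ∈ M.tot ↔ x ∈ L.tot) : L ≅ M where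
  hom :=
    { toFun := e
      map_sup' := e.map_sup
      map_inf' := e.map_inf
      map_tt := htt
      map_ff := hff
      map_con := fun x => (hcon x).2
      map_tot := fun x => (htot x).2 }
  inv :=
    { toFun := e.symm
      map_sup' := e.symm.map_sup
      map_inf' := e.symm.map_inf
      map_tt := by simp [← htt]
      map_ff := by simp [← hff]
      map_con := fun x hx => (hcon _).1 (by simpa using hx)
      map_tot := fun x hx => (htot _).1 (by simpa using hx) }
  hom_inv_id := hom_ext fun x => e.symm_apply_apply x
  inv_hom_id := hom_ext fun x => e.apply_symm_apply x

/-- The d-lattice `B × Bᵒᵈ` of a bounded distributive lattice `B`: a pair `(a, b)` is consistent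
if `a ≤ b` and total if `b ≤ a`. -/
abbrev ofLattice (B : Type u) [DistribLattice B] [BoundedOrder B] : DLat.{u} where
  carrier := B × Bᵒᵈ
  tt := (⊤, ⊥)
  ff := (⊥, ⊤)
  isCompl_tt_ff := IsCompl.of_eq (by ext <;> simp) (by ext <;> simp)
  con := {x | x.1 ≤ ofDual x.2}
  tot := {x | ofDual x.2 ≤ x.1}
  tt_mem_con := le_rfl
  ff_mem_con := le_rfl
  tt_mem_tot := le_rfl
  ff_mem_tot := le_rfl
  con_isLowerSet := fun _ _ hyx hx => hyx.1.trans (hx.trans (ofDual_le_ofDual.2 hyx.2))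
  con_dirSupClosed := by
    intro d hd _ hdir a ha
    rw [isLUB_prod] at ha
    refine ha.1.2 ?_
    rintro _ ⟨x, hx, rfl⟩
    refine toDual_le_toDual.1 (ha.2.2 ?_)
    rintro _ ⟨y, hy, rfl⟩
    -- A common upper bound `z` of `x` and `y` links the two coordinates: `x.1 ≤ z.1 ≤ z.2 ≤ y.2`,
    -- read in `B`.
    obtain ⟨z, hz, hxz, hyz⟩ := hdir x hx y hy
    exact hxz.1.trans ((hd hz).trans (ofDual_le_ofDual.2 hyz.2))
  tot_isUpperSet := fun _ _ hxy hx => (ofDual_le_ofDual.2 hxy.2).trans (hx.trans hxy.1)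
  con_logicMeet := by
    rintro ⟨a, b⟩ (h : a ≤ ofDual b) ⟨a', b'⟩ (h' : a' ≤ ofDual b')
    simpa using ⟨inf_le_left.trans h, inf_le_right.trans h'⟩
  con_logicJoin := by
    rintro ⟨a, b⟩ (h : a ≤ ofDual b) ⟨a', b'⟩ (h' : a' ≤ ofDual b')
    simpa using ⟨h.trans le_sup_left, h'.trans le_sup_right⟩
  tot_logicMeet := by
    rintro ⟨a, b⟩ (h : ofDual b ≤ a) ⟨a', b'⟩ (h' : ofDual b' ≤ a')
    simpa using ⟨inf_le_left.trans h, inf_le_right.trans h'⟩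
  tot_logicJoin := by
    rintro ⟨a, b⟩ (h : ofDual b ≤ a) ⟨a', b'⟩ (h' : ofDual b' ≤ a')
    simpa using ⟨h.trans le_sup_left, h'.trans le_sup_right⟩
  con_tot := by
    rintro ⟨a, b⟩ (h : a ≤ ofDual b) ⟨a', b'⟩ (h' : ofDual b' ≤ a') (e | e)
    · obtain rfl : a = a' := by simpa using congrArg Prod.fst e
      exact ⟨le_rfl, h'.trans h⟩
    · obtain rfl : b = b' := by simpa using congrArg Prod.snd e
      exact ⟨h.trans h', le_rfl⟩

section ofLattice

variable {B B' : Type u} [DistribLattice B] [BoundedOrder B] [DistribLattice B'] [BoundedOrder B']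

theorem isDBoolean_ofLattice : (ofLattice B).IsDBoolean := by
  rintro ⟨a, b⟩ (h | h)
  · refine Or.inl ⟨h, (⊥, toDual a), ⟨le_rfl, le_top⟩, ?_⟩
    obtain rfl : b = ⊥ := le_bot_iff.1 h.2
    simp
  · refine Or.inr ⟨h, (ofDual b, ⊥), ⟨le_top, le_rfl⟩, ?_⟩
    obtain rfl : a = ⊥ := le_bot_iff.1 h.1
    simp

theorem isComplete_ofLattice (h : ∀ S : Set B, ∃ a, IsLUB S a) : (ofLattice B).IsComplete := by
  have h' (S : Set B) : ∃ a, IsGLB S a := (h (lowerBounds S)).imp fun _ => isLUB_lowerBounds.1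
  have hsup (S : Set (B × Bᵒᵈ)) : ∃ a, IsLUB S a := by
    obtain ⟨a, ha⟩ := h (Prod.fst '' S)
    obtain ⟨b, hb⟩ := h' (toDual ⁻¹' (Prod.snd '' S))
    exact ⟨(a, toDual b), isLUB_prod.2 ⟨ha, hb.dual⟩⟩
  exact fun S => ⟨hsup S, (hsup (lowerBounds S)).imp fun _ => isLUB_lowerBounds.1⟩

/-- The d-lattice homomorphism induced by a homomorphism of bounded lattices. -/
def mapOfLattice (f : BoundedLatticeHom B B') : ofLattice B ⟶ ofLattice B' :=
  { toFun := fun x : B × Bᵒᵈ => (f x.1, toDual (f (ofDual x.2)))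
    map_sup' := fun x y => by simp
    map_inf' := fun x y => by simp
    map_tt := by simp
    map_ff := by simp
    map_con := fun x hx => OrderHomClass.mono f hx
    map_tot := fun x hx => OrderHomClass.mono f hx : DLat.Hom _ _ }

theorem mapOfLattice_injective :
    Function.Injective (mapOfLattice : BoundedLatticeHom B B' → _) := fun f g h => by
  ext a
  exact congrArg (fun k : ofLattice B ⟶ ofLattice B' => (k.toLatticeHom (a, ⊥)).1) h

/-- Meeting with `tt` shows that the first coordinate of `k x` depends only on `x.1`, which defines
`f`. The diagonal is `con ∩ tot`, so `k` preserves it, and this forces the second coordinate to be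
`f` as well. -/
theorem mapOfLattice_surjective :
    Function.Surjective (mapOfLattice : BoundedLatticeHom B B' → _) := by
  intro k
  have hsup (x y) : k.toLatticeHom (x ⊔ y) = k.toLatticeHom x ⊔ k.toLatticeHom y := k.map_sup' x y
  have hinf (x y) : k.toLatticeHom (x ⊓ y) = k.toLatticeHom x ⊓ k.toLatticeHom y := k.map_inf' x y
  have htt : k.toLatticeHom (⊤, ⊥) = (⊤, ⊥) := k.map_tt
  have hff : k.toLatticeHom (⊥, ⊤) = (⊥, ⊤) := k.map_ff
  have hbot : k.toLatticeHom ⊥ = ⊥ := by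
    have := hinf (⊤, ⊥) (⊥, ⊤)
    rw [show ((⊤, ⊥) ⊓ (⊥, ⊤) : B × Bᵒᵈ) = ⊥ by ext <;> simp, htt, hff] at this
    exact this.trans (by ext <;> simp)
  let f : BoundedLatticeHom B B' :=
    { toFun := fun a => (k.toLatticeHom (a, ⊥)).1
      map_sup' := fun a b => by
        have := hsup (a, ⊥) (b, ⊥)
        simp only [Prod.mk_sup_mk, sup_idem] at this
        rw [this]; rfl
      map_inf' := fun a b => by
        have := hinf (a, ⊥) (b, ⊥)
        simp only [Prod.mk_inf_mk, inf_idem] at this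
        rw [this]; rfl
      map_top' := congrArg Prod.fst htt
      map_bot' := congrArg Prod.fst hbot }
  have h1 (x : B × Bᵒᵈ) : (k.toLatticeHom x).1 = f x.1 := by
    have := hinf x (⊤, ⊥)
    rw [htt] at this
    rw [show (x ⊓ (⊤, ⊥) : B × Bᵒᵈ) = (x.1, ⊥) by ext <;> simp] at this
    exact ((congrArg Prod.fst this).trans (inf_top_eq _)).symm
  have h2 (b : B) : k.toLatticeHom (b, toDual b) = (f b, toDual (f b)) := by
    have hc : f b ≤ ofDual (k.toLatticeHom (b, toDual b)).2 := by
      rw [← h1 (b, toDual b)]; exact k.map_con _ le_rfl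
    have ht : ofDual (k.toLatticeHom (b, toDual b)).2 ≤ f b := by
      rw [← h1 (b, toDual b)]; exact k.map_tot _ le_rfl
    exact Prod.ext (h1 _) (congrArg toDual (ht.antisymm hc))
  refine ⟨f, hom_ext fun x => Prod.ext (h1 x).symm ?_⟩
  have e : (x ⊓ (⊥, ⊤) : B × Bᵒᵈ) = (ofDual x.2, x.2) ⊓ (⊥, ⊤) := by ext <;> simp
  have e' := congrArg (fun z => (k.toLatticeHom z).2) e
  simp only [hinf, hff] at e'
  have e'' := congrArg Prod.snd (h2 (ofDual x.2))
  exact e''.symm.trans (by simpa using e'.symm)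

/-- Isomorphic lattices have isomorphic d-lattices. -/
def isoOfLattice (e : B ≃o B') : ofLattice B ≅ ofLattice B' :=
  isoOfOrderIso (L := ofLattice B) (M := ofLattice B')
    { toEquiv := e.toEquiv.prodCongr e.dual.toEquiv
      map_rel_iff' := and_congr e.le_iff_le e.dual.le_iff_le }
    (Prod.ext e.map_top e.dual.map_bot) (Prod.ext e.map_bot e.dual.map_top)
    (fun x => e.le_iff_le (x := x.1) (y := ofDual x.2))
    (fun x => e.le_iff_le (x := ofDual x.2) (y := x.1))

end ofLattice

/-! ### The involution of a d-Boolean algebra -/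

section involution

variable {L : DLat.{u}}

theorem inf_tt_sup_inf_ff (x : L) : x ⊓ L.tt ⊔ x ⊓ L.ff = x := by
  rw [← inf_sup_left, L.isCompl_tt_ff.sup_eq_top, inf_top_eq]

theorem sup_inf_tt (x y : L) : (x ⊓ L.tt ⊔ y ⊓ L.ff) ⊓ L.tt = x ⊓ L.tt := by
  rw [inf_sup_right, inf_assoc, inf_idem, inf_assoc, L.isCompl_tt_ff.symm.inf_eq_bot, inf_bot_eq,
    sup_bot_eq]

theorem sup_inf_ff (x y : L) : (x ⊓ L.tt ⊔ y ⊓ L.ff) ⊓ L.ff = y ⊓ L.ff := by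
  rw [inf_sup_right, inf_assoc, inf_assoc, L.isCompl_tt_ff.inf_eq_bot, inf_bot_eq, inf_idem,
    bot_sup_eq]

theorem le_of_inf_le {x y : L} (h : x ⊓ L.tt ≤ y ⊓ L.tt) (h' : x ⊓ L.ff ≤ y ⊓ L.ff) : x ≤ y := by
  rw [← inf_tt_sup_inf_ff x, ← inf_tt_sup_inf_ff y]
  exact sup_le_sup h h'

/-- Here and in the next three lemmas, a consistent and a total element share one component, so
`con_tot` compares the other one. -/
theorem le_of_mem_con {x y : L} (hx : x ∈ L.con) (h : y ⊓ L.tt ⊔ x ⊓ L.ff ∈ L.tot) :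
    x ⊓ L.tt ≤ y ⊓ L.tt := by
  have := L.con_tot _ hx _ h (Or.inr (sup_inf_ff _ _).symm)
  simpa only [sup_inf_tt] using inf_le_inf_right L.tt this

theorem le_of_mem_con' {x y : L} (hx : x ∈ L.con) (h : x ⊓ L.tt ⊔ y ⊓ L.ff ∈ L.tot) :
    x ⊓ L.ff ≤ y ⊓ L.ff := by
  have := L.con_tot _ hx _ h (Or.inl (sup_inf_tt _ _).symm)
  simpa only [sup_inf_ff] using inf_le_inf_right L.ff this

theorem le_of_mem_tot {x y : L} (hx : x ∈ L.tot) (h : y ⊓ L.tt ⊔ x ⊓ L.ff ∈ L.con) :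
    y ⊓ L.tt ≤ x ⊓ L.tt := by
  have := L.con_tot _ h _ hx (Or.inr (sup_inf_ff _ _))
  simpa only [sup_inf_tt] using inf_le_inf_right L.tt this

theorem le_of_mem_tot' {x y : L} (hx : x ∈ L.tot) (h : x ⊓ L.tt ⊔ y ⊓ L.ff ∈ L.con) :
    y ⊓ L.ff ≤ x ⊓ L.ff := by
  have := L.con_tot _ h _ hx (Or.inl (sup_inf_tt _ _))
  simpa only [sup_inf_ff] using inf_le_inf_right L.ff this

/-- The components of `y` are the d-complements of the components of `x`. -/
def IsNeg (x y : L) : Prop :=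
  x ⊓ L.tt ⊔ y ⊓ L.ff ∈ L.con ∩ L.tot ∧ y ⊓ L.tt ⊔ x ⊓ L.ff ∈ L.con ∩ L.tot

theorem IsNeg.symm {x y : L} (h : IsNeg x y) : IsNeg y x := ⟨h.2, h.1⟩

/-- As `con` is a lower set, `x'` may be lowered to `x` in the consistent pairs with `y'`; these
share the component of `x` with the total pairs of `x` and `y`. The case `x = x'` gives uniqueness
of the negation. -/
theorem IsNeg.anti {x y x' y' : L} (h : IsNeg x y) (h' : IsNeg x' y') (hx : x ≤ x') : y' ≤ y := by
  have hc1 : x ⊓ L.tt ⊔ y' ⊓ L.ff ∈ L.con :=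
    L.con_isLowerSet (sup_le_sup_right (inf_le_inf_right _ hx) _) h'.1.1
  have hc2 : y' ⊓ L.tt ⊔ x ⊓ L.ff ∈ L.con :=
    L.con_isLowerSet (sup_le_sup_left (inf_le_inf_right _ hx) _) h'.2.1
  have h1 := L.con_tot _ hc1 _ h.1.2 (Or.inl (by simp only [sup_inf_tt]))
  have h2 := L.con_tot _ hc2 _ h.2.2 (Or.inr (by simp only [sup_inf_ff]))
  refine le_of_inf_le ?_ ?_
  · simpa only [sup_inf_tt] using inf_le_inf_right L.tt h2
  · simpa only [sup_inf_ff] using inf_le_inf_right L.ff h1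

theorem IsNeg.mem_con {x y : L} (h : IsNeg x y) : x ∈ L.con ↔ x ≤ y := by
  refine ⟨fun hx => le_of_inf_le (le_of_mem_con hx h.2.2) (le_of_mem_con' hx h.1.2), fun hxy => ?_⟩
  refine L.con_isLowerSet ?_ h.1.1
  nth_rw 1 [← inf_tt_sup_inf_ff x]
  exact sup_le_sup_left (inf_le_inf_right _ hxy) _

theorem IsNeg.mem_tot {x y : L} (h : IsNeg x y) : x ∈ L.tot ↔ y ≤ x := by
  refine ⟨fun hx => le_of_inf_le (le_of_mem_tot hx h.2.1) (le_of_mem_tot' hx h.1.1), fun hxy => ?_⟩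
  refine L.tot_isUpperSet ?_ h.1.2
  exact (sup_le_sup_left (inf_le_inf_right _ hxy) _).trans_eq (inf_tt_sup_inf_ff x)

theorem IsDBoolean.exists_isNeg (hL : L.IsDBoolean) (x : L) : ∃ y, IsNeg x y := by
  have h1 : ∃ b ≤ L.ff, x ⊓ L.tt ⊔ b ∈ L.con ∩ L.tot := by
    -- The disjunction may offer a complement on the wrong side, but then the element lies below
    -- both `tt` and `ff`, hence is `⊥`, with complement `ff`.
    rcases hL (x ⊓ L.tt) (Or.inl inf_le_right) with h | ⟨h, -⟩
    · exact h.2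
    · have h0 : x ⊓ L.tt = ⊥ := le_bot_iff.1 (L.isCompl_tt_ff.disjoint inf_le_right h)
      exact ⟨L.ff, le_rfl, by rw [h0, bot_sup_eq]; exact ⟨L.ff_mem_con, L.ff_mem_tot⟩⟩
  have h2 : ∃ a ≤ L.tt, a ⊔ x ⊓ L.ff ∈ L.con ∩ L.tot := by
    rcases hL (x ⊓ L.ff) (Or.inr inf_le_right) with ⟨h, -⟩ | h
    · have h0 : x ⊓ L.ff = ⊥ := le_bot_iff.1 (L.isCompl_tt_ff.disjoint h inf_le_right)
      exact ⟨L.tt, le_rfl, by rw [h0, sup_bot_eq]; exact ⟨L.tt_mem_con, L.tt_mem_tot⟩⟩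
    · exact h.2
  obtain ⟨b, hb, hxb⟩ := h1
  obtain ⟨a, ha, hxa⟩ := h2
  have e1 := sup_inf_tt a b
  have e2 := sup_inf_ff a b
  rw [inf_eq_left.2 ha, inf_eq_left.2 hb] at e1 e2
  exact ⟨a ⊔ b, by rwa [e2], by rwa [e1]⟩

instance {α : Type*} [DistribLattice α] (a : α) : DistribLattice (Set.Iic a) where
  le_sup_inf x y z := le_sup_inf (x := x.1) (y := y.1) (z := z.1)

/-- A d-Boolean algebra `L` is isomorphic to `L₊ × L₊ᵒᵈ`. -/
theorem IsDBoolean.nonempty_iso (hL : L.IsDBoolean) :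
    Nonempty (L ≅ ofLattice (Set.Iic L.tt)) := by
  choose n hn using hL.exists_isNeg
  have nn (x : L) : n (n x) = x :=
    ((hn x).symm.anti (hn (n x)) le_rfl).antisymm ((hn (n x)).anti (hn x).symm le_rfl)
  have nle {x y : L} : n x ≤ n y ↔ y ≤ x := by
    refine ⟨fun h => ?_, (hn _).anti (hn _)⟩
    simpa only [nn] using (hn _).anti (hn _) h
  have nsup (x y : L) : n (x ⊔ y) = n x ⊓ n y := by
    refine le_antisymm (le_inf (nle.2 le_sup_left) (nle.2 le_sup_right)) ?_
    rw [← nle, nn]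
    refine sup_le ?_ ?_
    · rw [← nle, nn]; exact inf_le_left
    · rw [← nle, nn]; exact inf_le_right
  have ntt : n L.tt = L.tt := by
    have h : IsNeg L.tt L.tt := by
      simpa only [IsNeg, inf_tt_sup_inf_ff, and_self] using ⟨L.tt_mem_con, L.tt_mem_tot⟩
    exact (h.anti (hn _) le_rfl).antisymm ((hn _).anti h le_rfl)
  have nff : n L.ff = L.ff := by
    have h : IsNeg L.ff L.ff := by
      simpa only [IsNeg, inf_tt_sup_inf_ff, and_self] using ⟨L.ff_mem_con, L.ff_mem_tot⟩
    exact (h.anti (hn _) le_rfl).antisymm ((hn _).anti h le_rfl)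
  -- Since `n` fixes `tt`, `n x ⊓ tt = n (x ⊔ tt)`, and `x ⊔ tt` carries the same information as `x
  -- ⊓ ff`. So the `L₋` component is encoded, in reverse order, inside `L₊`.
  have ntt_le {x y : L} : n x ⊓ L.tt ≤ n y ⊓ L.tt ↔ y ⊓ L.ff ≤ x ⊓ L.ff := by
    nth_rw 1 2 [← ntt]
    rw [← nsup, ← nsup, nle]
    constructor
    · intro h
      have := inf_le_inf_right L.ff h
      simpa only [inf_sup_right, L.isCompl_tt_ff.inf_eq_bot, sup_bot_eq] using this
    · intro h
      have := sup_le_sup_right h L.tt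
      simpa only [sup_inf_right, L.isCompl_tt_ff.symm.sup_eq_top, inf_top_eq] using this
  let e : L ↪o Set.Iic L.tt × (Set.Iic L.tt)ᵒᵈ :=
    { toFun := fun x => (⟨x ⊓ L.tt, inf_le_right⟩, toDual ⟨n x ⊓ L.tt, inf_le_right⟩)
      inj' := fun x y h => by
        have h1 : x ⊓ L.tt = y ⊓ L.tt := congrArg (fun z => z.1.1) h
        have h2 : n x ⊓ L.tt = n y ⊓ L.tt := congrArg (fun z => (ofDual z.2).1) h
        exact (le_of_inf_le h1.le (ntt_le.1 h2.ge)).antisymm (le_of_inf_le h1.ge (ntt_le.1 h2.le))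
      map_rel_iff' := fun {x y} =>
        ⟨fun h => le_of_inf_le h.1 (ntt_le.1 h.2),
          fun h => ⟨inf_le_inf_right _ h, inf_le_inf_right _ (nle.2 h)⟩⟩ }
  have he : Function.Surjective e := by
    rintro ⟨⟨a, ha : a ≤ L.tt⟩, ⟨b, hb : b ≤ L.tt⟩⟩
    have e1 := sup_inf_tt a (n b)
    have e2 := sup_inf_ff a (n b)
    rw [inf_eq_left.2 ha] at e1 e2
    refine ⟨a ⊔ n b ⊓ L.ff, Prod.ext (Subtype.ext e1) (Subtype.ext ?_)⟩
    have h1 := ntt_le.2 e2.le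
    have h2 := ntt_le.2 e2.ge
    rw [nn, inf_eq_left.2 hb] at h1 h2
    exact h2.antisymm h1
  refine ⟨isoOfOrderIso (M := ofLattice (Set.Iic L.tt)) (RelIso.ofSurjective e he) ?_ ?_
    (fun x => ?_) (fun x => ?_)⟩
  · refine Prod.ext (Subtype.ext (inf_idem _)) (Subtype.ext ?_)
    exact (congrArg (· ⊓ L.tt) ntt).trans (inf_idem _)
  · refine Prod.ext (Subtype.ext L.isCompl_tt_ff.symm.inf_eq_bot) (Subtype.ext ?_)
    exact (congrArg (· ⊓ L.tt) nff).trans L.isCompl_tt_ff.symm.inf_eq_bot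
  -- By `ntt_le` and `n (n x) = x`, the `ff` half of `x ≤ n x` is equivalent to its `tt` half.
  · rw [(hn x).mem_con]
    refine ⟨fun h => le_of_inf_le h (ntt_le.1 ?_), fun h => inf_le_inf_right _ h⟩
    rw [nn]; exact h
  · rw [(hn x).mem_tot]
    refine ⟨fun h => le_of_inf_le h (ntt_le.1 ?_), fun h => inf_le_inf_right _ h⟩
    rw [nn]; exact h

theorem IsComplete.exists_isLUB_Iic_tt (hL : L.IsComplete) (S : Set (Set.Iic L.tt)) :
    ∃ a, IsLUB S a := by
  obtain ⟨a, ha⟩ := (hL (Subtype.val '' S)).1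
  have ha' : a ≤ L.tt := ha.2 (by rintro _ ⟨x, -, rfl⟩; exact x.2)
  refine ⟨⟨a, ha'⟩, fun x hx => ha.1 ⟨x, hx, rfl⟩, fun b hb => ha.2 ?_⟩
  rintro _ ⟨x, hx, rfl⟩
  exact hb hx

end involution
end DLat
end DBoolean

namespace DBoolean

/-! ### The lattice of `τ₊`-open `τ₋`-closed sets -/

/-- The topology is found by unification rather than instance search, so that both topologies of a
space can be used. -/
theorem exists_mem_basis_subset {α : Type*} {t : TopologicalSpace α} {B : Set (Set α)}
    (hB : @TopologicalSpace.IsTopologicalBasis α t B) {x : α} {U : Set α} (hx : x ∈ U)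
    (hU : IsOpen[t] U) : ∃ V ∈ B, x ∈ V ∧ V ⊆ U :=
  hB.exists_subset_of_mem_open hx hU

namespace BiTop

@[ext]
theorem hom_ext {X Y : BiTop.{u}} {f g : X ⟶ Y} (h : ∀ x, f.toFun x = g.toFun x) : f = g := by
  obtain ⟨f, _, _⟩ := f
  obtain ⟨g, _, _⟩ := g
  obtain rfl : f = g := funext h
  rfl

/-- The lattice of `τ₊`-open `τ₋`-closed sets. -/
def clp (X : BiTop.{u}) : Sublattice (Set X) where
  carrier := {U | IsOpen[X.plus] U ∧ IsClosed[X.minus] U}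
  supClosed' := fun _ hU _ hV =>
    ⟨@IsOpen.union _ _ _ X.plus hU.1 hV.1, @IsClosed.union _ _ _ X.minus hU.2 hV.2⟩
  infClosed' := fun _ hU _ hV =>
    ⟨@IsOpen.inter _ X.plus _ _ hU.1 hV.1, @IsClosed.inter _ _ _ X.minus hU.2 hV.2⟩

theorem mem_clp {X : BiTop.{u}} {U : Set X} :
    U ∈ X.clp ↔ IsOpen[X.plus] U ∧ IsClosed[X.minus] U := Iff.rfl

theorem isOpen_of_mem_clp {X : BiTop.{u}} {U : Set X} (h : U ∈ X.clp) : IsOpen[X.plus] U := h.1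

theorem isClosed_of_mem_clp {X : BiTop.{u}} {U : Set X} (h : U ∈ X.clp) : IsClosed[X.minus] U :=
  h.2

theorem isOpen_compl_of_mem_clp {X : BiTop.{u}} {U : Set X} (h : U ∈ X.clp) :
    IsOpen[X.minus] Uᶜ :=
  (@isOpen_compl_iff _ _ X.minus).2 h.2

instance (X : BiTop.{u}) : BoundedOrder X.clp where
  top := ⟨Set.univ, mem_clp.2 ⟨@isOpen_univ _ X.plus, @isClosed_univ _ X.minus⟩⟩
  bot := ⟨∅, mem_clp.2 ⟨@isOpen_empty _ X.plus, @isClosed_empty _ X.minus⟩⟩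
  le_top U := Set.subset_univ U.1
  bot_le U := Set.empty_subset U.1

/-- The preimage map on `τ₊`-open `τ₋`-closed sets. -/
def clpMap {X Y : BiTop.{u}} (f : X ⟶ Y) : BoundedLatticeHom Y.clp X.clp where
  toFun U := ⟨f.toFun ⁻¹' U.1, mem_clp.2
    ⟨(@continuous_def _ _ X.plus Y.plus _).1 f.continuous_plus _ (isOpen_of_mem_clp U.2),
    (@continuous_iff_isClosed _ _ X.minus Y.minus _).1 f.continuous_minus _
      (isClosed_of_mem_clp U.2)⟩⟩
  map_sup' _ _ := rfl
  map_inf' _ _ := rfl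
  map_top' := rfl
  map_bot' := rfl

theorem IsZeroDimensional.exists_clp {X : BiTop.{u}} (hX : X.IsZeroDimensional) {U : Set X} {x : X}
    (hU : IsOpen[X.plus] U) (hx : x ∈ U) : ∃ V ∈ X.clp, x ∈ V ∧ V ⊆ U := by
  obtain ⟨B, hB, hBc⟩ := hX.1
  obtain ⟨V, hV, hxV, hVU⟩ := exists_mem_basis_subset hB hx hU
  exact ⟨V, mem_clp.2
    ⟨@TopologicalSpace.IsTopologicalBasis.isOpen _ X.plus _ _ hB hV, hBc V hV⟩, hxV, hVU⟩

theorem IsZeroDimensional.exists_compl_clp {X : BiTop.{u}} (hX : X.IsZeroDimensional) {U : Set X}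
    {x : X} (hU : IsOpen[X.minus] U) (hx : x ∈ U) : ∃ V ∈ X.clp, x ∉ V ∧ Vᶜ ⊆ U := by
  obtain ⟨B, hB, hBc⟩ := hX.2
  obtain ⟨V, hV, hxV, hVU⟩ := exists_mem_basis_subset hB hx hU
  refine ⟨Vᶜ, mem_clp.2 ⟨(@isOpen_compl_iff _ _ X.plus).2 (hBc V hV), ?_⟩, not_not_intro hxV,
    by rwa [compl_compl]⟩
  exact @IsOpen.isClosed_compl _ X.minus _
    (@TopologicalSpace.IsTopologicalBasis.isOpen _ X.minus _ _ hB hV)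

theorem IsStone.eq_of_clp {X : BiTop.{u}} (hX : X.IsStone) {x y : X}
    (h : ∀ U ∈ X.clp, x ∈ U ↔ y ∈ U) : x = y := by
  by_contra hxy
  obtain ⟨U, hU | hU, ⟨hx, hy⟩ | ⟨hx, hy⟩⟩ := hX.1 x y hxy
  · obtain ⟨V, hV, hxV, hVU⟩ := hX.2.2.exists_clp hU hx
    exact hy (hVU ((h V hV).1 hxV))
  · obtain ⟨V, hV, hxV, hVU⟩ := hX.2.2.exists_clp hU hx
    exact hy (hVU ((h V hV).2 hxV))
  · obtain ⟨V, hV, hxV, hVU⟩ := hX.2.2.exists_compl_clp hU hx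
    exact hy (hVU fun hyV => hxV ((h V hV).2 hyV))
  · obtain ⟨V, hV, hxV, hVU⟩ := hX.2.2.exists_compl_clp hU hx
    exact hy (hVU fun hyV => hxV ((h V hV).1 hyV))

theorem clpMap_injective {X Y : BiTop.{u}} (hY : Y.IsStone) :
    Function.Injective (clpMap : (X ⟶ Y) → _) := fun f g h =>
  hom_ext fun x => hY.eq_of_clp fun U hU => by
    have := congrArg (fun k : BoundedLatticeHom Y.clp X.clp => x ∈ (k ⟨U, hU⟩).1) h
    exact this.to_iff

/-- In a compact space, each homomorphism from `clp X` to `Prop` is given by a point. -/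
theorem IsCompact.exists_point {X : BiTop.{u}} (hX : X.IsCompact)
    (p : BoundedLatticeHom X.clp Prop) : ∃ x : X, ∀ U : X.clp, x ∈ U.1 ↔ p U := by
  by_contra! hp
  -- If no point realizes `p`, the sets on which `p` is violated cover `X`.
  obtain ⟨F, hFC, hF, hFu⟩ := hX {W | ∃ U : X.clp, (p U ∧ W = U.1ᶜ) ∨ (¬ p U ∧ W = U.1)}
    (by
      rintro _ ⟨U, ⟨-, rfl⟩ | ⟨-, rfl⟩⟩
      · exact Or.inr (isOpen_compl_of_mem_clp U.2)
      · exact Or.inl (isOpen_of_mem_clp U.2))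
    (by
      refine Set.eq_univ_of_forall fun x => ?_
      obtain ⟨U, ⟨h1, h2⟩ | ⟨h1, h2⟩⟩ := hp x
      · exact ⟨U.1, ⟨U, Or.inr ⟨h2, rfl⟩⟩, h1⟩
      · exact ⟨U.1ᶜ, ⟨U, Or.inl ⟨h2, rfl⟩⟩, h1⟩)
  -- As `p` preserves finite meets and joins, a finite subcover collapses to one pair; then `U ≤ V`
  -- contradicts monotonicity of `p`.
  have key : ∃ U V : X.clp, p U ∧ ¬ p V ∧ ⋃₀ F ⊆ U.1ᶜ ∪ V.1 := by
    clear hFu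
    induction F, hF using Set.Finite.induction_on with
    | empty => exact ⟨⊤, ⊥, by simp [map_top], by simp [map_bot], by simp⟩
    | insert _ _ ih =>
      obtain ⟨U, V, hU, hV, hUV⟩ := ih ((Set.subset_insert _ _).trans hFC)
      obtain ⟨T, ⟨hT, rfl⟩ | ⟨hT, rfl⟩⟩ := hFC (Set.mem_insert _ _)
      · refine ⟨U ⊓ T, V, by rw [map_inf]; exact ⟨hU, hT⟩, hV, ?_⟩
        rw [Set.sUnion_insert]
        rintro x (hx | hx)
        · exact Or.inl fun h => hx h.2
        · exact (hUV hx).imp (fun h h' => h h'.1) id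
      · refine ⟨U, V ⊔ T, hU, by rw [map_sup]; exact fun h => h.elim hV hT, ?_⟩
        rw [Set.sUnion_insert]
        rintro x (hx | hx)
        · exact Or.inr (Or.inr hx)
        · exact (hUV hx).imp id Or.inl
  obtain ⟨U, V, hU, hV, hUV⟩ := key
  have hle : U ≤ V := fun x hx => ((hUV (hFu ▸ Set.mem_univ x)).resolve_left (not_not_intro hx))
  exact hV (OrderHomClass.mono p hle hU)

/-- The point `x` as a homomorphism from `clp X` to `Prop`. -/
def evalClp {X : BiTop.{u}} (x : X) : BoundedLatticeHom X.clp Prop where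
  toFun U := x ∈ U.1
  map_sup' _ _ := rfl
  map_inf' _ _ := rfl
  map_top' := rfl
  map_bot' := rfl

/-- Evaluation at `x` composed with `h` is realized by a point `f x` of `Y`. Then `f ⁻¹' U = h U` on
`clp Y`, and continuity follows since these sets and their complements form bases. -/
theorem clpMap_surjective {X Y : BiTop.{u}} (hY : Y.IsStone) :
    Function.Surjective (clpMap : (X ⟶ Y) → _) := by
  intro h
  choose f hf using fun x : X => hY.2.1.exists_point ((evalClp x).comp h)
  have hf' (U : Y.clp) : f ⁻¹' U.1 = (h U).1 := Set.ext fun x => hf x U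
  refine ⟨{ toFun := f, continuous_plus := ?_, continuous_minus := ?_ }, ?_⟩
  · refine @Continuous.mk _ _ X.plus Y.plus _ fun U hU => ?_
    refine (@isOpen_iff_forall_mem_open _ X.plus _).2 fun x hx => ?_
    obtain ⟨V, hV, hxV, hVU⟩ := hY.2.2.exists_clp hU hx
    exact ⟨_, Set.preimage_mono hVU, hf' ⟨V, hV⟩ ▸ isOpen_of_mem_clp (h ⟨V, hV⟩).2, hxV⟩
  · refine @Continuous.mk _ _ X.minus Y.minus _ fun U hU => ?_
    refine (@isOpen_iff_forall_mem_open _ X.minus _).2 fun x hx => ?_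
    obtain ⟨V, hV, hxV, hVU⟩ := hY.2.2.exists_compl_clp hU hx
    refine ⟨_, Set.preimage_mono hVU, ?_, hxV⟩
    rw [Set.preimage_compl, hf' ⟨V, hV⟩]
    exact isOpen_compl_of_mem_clp (h ⟨V, hV⟩).2
  · ext U : 1
    exact Subtype.ext (hf' U)

/-- The `τ₋`-closure of the union is the supremum; extremal disconnectedness keeps it `τ₊`-open. -/
theorem IsExtremallyDisconnected.exists_isLUB {X : BiTop.{u}} (hX : X.IsExtremallyDisconnected)
    (S : Set X.clp) : ∃ a, IsLUB S a := by
  let W : Set X := ⋃ U ∈ S, U.1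
  have hW : IsOpen[X.plus] W :=
    @isOpen_biUnion _ _ X.plus _ _ fun U _ => isOpen_of_mem_clp U.2
  refine ⟨⟨closure[X.minus] W, mem_clp.2 ⟨hX.1 W hW, @isClosed_closure X X.minus W⟩⟩, fun U hU => ?_,
    fun V hV => ?_⟩
  · exact (Set.subset_biUnion_of_mem (u := fun U : X.clp => U.1) hU).trans
      (@subset_closure X X.minus W)
  · exact @closure_minimal _ X.minus _ _ (Set.iUnion₂_subset hV) (isClosed_of_mem_clp V.2)

end BiTop

/-! ### The spectrum of a bounded distributive lattice -/

section spectrum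

variable {B : Type u} [DistribLattice B] [BoundedOrder B]

/-- The homomorphisms to `Prop` separate the elements of a bounded distributive lattice. -/
theorem exists_boundedLatticeHom_prop {a b : B} (h : ¬ a ≤ b) :
    ∃ p : BoundedLatticeHom B Prop, p a ∧ ¬ p b := by
  obtain ⟨J, hJ, hbJ, haJ⟩ := DistribLattice.prime_ideal_of_disjoint_filter_ideal
    (F := Order.PFilter.principal a) (I := Order.Ideal.principal b)
    (Set.disjoint_left.2 fun x (hx : a ≤ x) (hx' : x ≤ b) => h (hx.trans hx'))
  -- The prime ideal `J` contains `b` and misses `a`; primeness is what makes its complement respect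
  -- meets.
  refine ⟨{ toFun := fun x => x ∉ J, map_sup' := fun x y => ?_, map_inf' := fun x y => ?_,
            map_top' := ?_, map_bot' := ?_ }, ?_, ?_⟩
  · simp only [Order.Ideal.sup_mem_iff, not_and_or]; rfl
  · refine propext ⟨fun hxy => ⟨fun hx => hxy (J.lower inf_le_left hx),
      fun hy => hxy (J.lower inf_le_right hy)⟩, fun hxy hm => ?_⟩
    exact (hJ.mem_or_mem hm).elim hxy.1 hxy.2
  · exact eq_true hJ.toIsProper.top_notMem
  · exact eq_false (not_not_intro J.bot_mem)
  · exact fun ha => Set.disjoint_left.1 haJ (le_refl a) ha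
  · exact not_not_intro (hbJ (le_refl b))

/-- The basic subset of the spectrum given by `a`. -/
def basic (a : B) : Set (BoundedLatticeHom B Prop) := {p | p a}

theorem basic_inf (a b : B) : basic (a ⊓ b) = basic a ∩ basic b :=
  Set.ext fun p => (map_inf p a b).to_iff

theorem basic_sup (a b : B) : basic (a ⊔ b) = basic a ∪ basic b :=
  Set.ext fun p => (map_sup p a b).to_iff

theorem basic_top : basic (⊤ : B) = Set.univ := Set.ext fun p => (map_top p).to_iff

theorem basic_bot : basic (⊥ : B) = ∅ := Set.ext fun p => (map_bot p).to_iff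

theorem basic_subset_basic {a b : B} : basic a ⊆ basic b ↔ a ≤ b := by
  refine ⟨fun h => ?_, fun h p => OrderHomClass.mono p h⟩
  by_contra hab
  obtain ⟨p, hpa, hpb⟩ := exists_boundedLatticeHom_prop hab
  exact hpb (h hpa)

variable (B) in
/-- The bitopological spectrum of a bounded distributive lattice. -/
abbrev spec : BiTop.{u} where
  carrier := BoundedLatticeHom B Prop
  plus := .generateFrom (Set.range basic)
  minus := .generateFrom (Set.range fun a => (basic a)ᶜ)

theorem isTopologicalBasis_spec_plus :
    @TopologicalSpace.IsTopologicalBasis _ (spec B).plus (Set.range (basic (B := B))) := by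
  refine @TopologicalSpace.isTopologicalBasis_of_subbasis_of_finiteInter _ (spec B).plus _ rfl
    ⟨⟨⊤, basic_top⟩, ?_⟩
  rintro _ ⟨a, rfl⟩ _ ⟨b, rfl⟩
  exact ⟨a ⊓ b, basic_inf a b⟩

theorem isTopologicalBasis_spec_minus :
    @TopologicalSpace.IsTopologicalBasis _ (spec B).minus
      (Set.range fun a : B => (basic a)ᶜ) := by
  refine @TopologicalSpace.isTopologicalBasis_of_subbasis_of_finiteInter _ (spec B).minus _ rfl
    ⟨⟨⊥, by simp [basic_bot]⟩, ?_⟩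
  rintro _ ⟨a, rfl⟩ _ ⟨b, rfl⟩
  exact ⟨a ⊔ b, by simp [basic_sup, Set.compl_union]⟩

theorem isOpen_basic (a : B) : IsOpen[(spec B).plus] (basic a) :=
  TopologicalSpace.isOpen_generateFrom_of_mem ⟨a, rfl⟩

theorem isOpen_compl_basic (a : B) : IsOpen[(spec B).minus] (basic a)ᶜ :=
  TopologicalSpace.isOpen_generateFrom_of_mem ⟨a, rfl⟩

theorem isClosed_basic (a : B) : IsClosed[(spec B).minus] (basic a) :=
  (@isOpen_compl_iff _ _ (spec B).minus).1 (isOpen_compl_basic a)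

theorem isClosed_compl_basic (a : B) : IsClosed[(spec B).plus] (basic a)ᶜ :=
  @IsOpen.isClosed_compl _ (spec B).plus _ (isOpen_basic a)

theorem isT0_spec : (spec B).IsT0 := by
  intro p q hpq
  obtain ⟨a, ha⟩ := DFunLike.ne_iff.1 hpq
  refine ⟨basic a, Or.inl (isOpen_basic a), ?_⟩
  change (p a ∧ ¬ q a) ∨ (q a ∧ ¬ p a)
  have : ¬ (p a ↔ q a) := fun h => ha (propext h)
  tauto

theorem isZeroDimensional_spec : (spec B).IsZeroDimensional :=
  ⟨⟨_, isTopologicalBasis_spec_plus, by rintro _ ⟨a, rfl⟩; exact isClosed_basic a⟩,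
    ⟨_, isTopologicalBasis_spec_minus, by rintro _ ⟨a, rfl⟩; exact isClosed_compl_basic a⟩⟩

/-- The limit of an ultrafilter on the spectrum. -/
def ultrafilterLim (𝒰 : Ultrafilter (BoundedLatticeHom B Prop)) : BoundedLatticeHom B Prop where
  toFun a := basic a ∈ 𝒰
  map_sup' a b := by rw [basic_sup]; exact propext Ultrafilter.union_mem_iff
  map_inf' a b := by rw [basic_inf]; exact propext Filter.inter_mem_iff
  map_top' := by rw [basic_top]; exact eq_true Filter.univ_mem
  map_bot' := by rw [basic_bot]; exact eq_false 𝒰.empty_notMem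

/-- Every ultrafilter `𝒰` converges, in both topologies, to the homomorphism `a ↦ basic a ∈ 𝒰`. Thus
the join of the topologies (an infimum in Mathlib's order) is compact. -/
theorem isCompact_spec : (spec B).IsCompact := by
  intro C hC hCu
  let T : TopologicalSpace (BoundedLatticeHom B Prop) := (spec B).plus ⊓ (spec B).minus
  have hc : _root_.IsCompact (Set.univ : Set (BoundedLatticeHom B Prop)) := by
    refine isCompact_iff_ultrafilter_le_nhds.2 fun 𝒰 _ => ⟨ultrafilterLim 𝒰, trivial, ?_⟩
    refine le_of_le_of_eq ?_ (_root_.nhds_inf (α := BoundedLatticeHom B Prop)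
      (t₁ := (spec B).plus) (t₂ := (spec B).minus)).symm
    rw [TopologicalSpace.nhds_generateFrom, TopologicalSpace.nhds_generateFrom]
    refine le_inf (le_iInf₂ ?_) (le_iInf₂ ?_)
    · rintro _ ⟨h, a, rfl⟩
      exact Filter.le_principal_iff.2 h
    · rintro _ ⟨h, a, rfl⟩
      exact Filter.le_principal_iff.2 (Ultrafilter.compl_mem_iff_notMem.2 h)
  obtain ⟨F, hFC, hF, hFu⟩ := hc.elim_finite_subcover_image (b := C) (c := id)
    (fun U hU => (hC U hU).elim
      (fun h => (inf_le_left : T ≤ (spec B).plus) _ h)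
      (fun h => (inf_le_right : T ≤ (spec B).minus) _ h))
    (by rw [← hCu, Set.sUnion_eq_biUnion]; rfl)
  exact ⟨F, hFC, hF, Set.univ_subset_iff.1 (by rw [Set.sUnion_eq_biUnion]; exact hFu)⟩

theorem isStone_spec : (spec B).IsStone := ⟨isT0_spec, isCompact_spec, isZeroDimensional_spec⟩

/-- The basic sets inside `U` together with `Uᶜ` cover the spectrum. By compactness finitely many
suffice, and a finite union of basic sets is basic. -/
theorem exists_eq_basic {U : Set (BoundedLatticeHom B Prop)} (hU : U ∈ (spec B).clp) :
    ∃ a : B, basic a = U := by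
  obtain ⟨F, hFC, hF, hFu⟩ := isCompact_spec
    {W : Set (BoundedLatticeHom B Prop) | W = Uᶜ ∨ ∃ a : B, basic a ⊆ U ∧ W = basic a}
    (by
      rintro _ (rfl | ⟨a, -, rfl⟩)
      · exact Or.inr (BiTop.isOpen_compl_of_mem_clp hU)
      · exact Or.inl (isOpen_basic a))
    (by
      refine Set.eq_univ_of_forall fun p => ?_
      by_cases hp : p ∈ U
      · obtain ⟨_, ⟨a, rfl⟩, hpa, haU⟩ :=
          exists_mem_basis_subset isTopologicalBasis_spec_plus hp (BiTop.isOpen_of_mem_clp hU)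
        exact ⟨_, Or.inr ⟨a, haU, rfl⟩, hpa⟩
      · exact ⟨_, Or.inl rfl, hp⟩)
  have key : ∃ a : B, basic a ⊆ U ∧ ⋃₀ F ⊆ Uᶜ ∪ basic a := by
    clear hFu
    induction F, hF using Set.Finite.induction_on with
    | empty => exact ⟨⊥, by simp [basic_bot], by simp⟩
    | insert _ _ ih =>
      obtain ⟨a, ha, haF⟩ := ih ((Set.subset_insert _ _).trans hFC)
      simp only [Set.sUnion_insert]
      obtain rfl | ⟨b, hb, rfl⟩ := hFC (Set.mem_insert _ _)
      · exact ⟨a, ha, Set.union_subset Set.subset_union_left haF⟩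
      · refine ⟨a ⊔ b, ?_, ?_⟩
        · rw [basic_sup]; exact Set.union_subset ha hb
        · rw [basic_sup]
          rintro p (hp | hp)
          · exact Or.inr (Or.inr hp)
          · exact (haF hp).imp id Or.inl
  obtain ⟨a, ha, haF⟩ := key
  refine ⟨a, ha.antisymm fun p hp => ?_⟩
  exact (haF (hFu ▸ Set.mem_univ p)).resolve_left (not_not_intro hp)

variable (B) in
/-- A bounded distributive lattice is isomorphic to the lattice `clp` of its spectrum. -/
noncomputable def orderIsoClp : B ≃o (spec B).clp :=
  RelIso.ofSurjective
    (OrderEmbedding.ofMapLEIff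
      (fun a => (⟨basic a, BiTop.mem_clp.2 ⟨isOpen_basic a, isClosed_basic a⟩⟩ : (spec B).clp))
      fun _ _ => basic_subset_basic)
    fun ⟨_, hU⟩ => (exists_eq_basic hU).imp fun _ h => Subtype.ext h

/-- The closure of `U` is `basic s`, with `s` the supremum of the `a` with `basic a ⊆ U`: if a
neighbourhood `(basic c)ᶜ` misses `U`, then `c` bounds all these `a`, so `s ≤ c`. The other half is
dual, with an infimum. -/
theorem isExtremallyDisconnected_spec (h : ∀ S : Set B, ∃ a, IsLUB S a) :
    (spec B).IsExtremallyDisconnected := by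
  constructor
  · intro U hU
    obtain ⟨s, hs⟩ := h {a | basic a ⊆ U}
    suffices closure[(spec B).minus] U = basic s from this ▸ isOpen_basic s
    refine (@closure_minimal _ (spec B).minus _ _ (fun p hp => ?_) (isClosed_basic s)).antisymm
      fun p hp => ?_
    · obtain ⟨_, ⟨a, rfl⟩, hpa, haU⟩ :=
        exists_mem_basis_subset isTopologicalBasis_spec_plus hp hU
      exact basic_subset_basic.2 (hs.1 haU) hpa
    · refine (@mem_closure_iff _ (spec B).minus _ _).2 fun V hV hpV => ?_
      obtain ⟨_, ⟨c, rfl⟩, hpc, hcV⟩ :=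
        exists_mem_basis_subset isTopologicalBasis_spec_minus hpV hV
      by_contra hne
      refine hpc (basic_subset_basic.2 (hs.2 fun a ha => basic_subset_basic.1 fun q hq => ?_) hp)
      by_contra hqc
      exact hne ⟨q, hcV hqc, ha hq⟩
  · intro U hU
    obtain ⟨s, hs⟩ := h (lowerBounds {a | (basic a)ᶜ ⊆ U})
    rw [isLUB_lowerBounds] at hs
    suffices closure[(spec B).plus] U = (basic s)ᶜ from this ▸ isOpen_compl_basic s
    refine (@closure_minimal _ (spec B).plus _ _ (fun p hp => ?_)
      (isClosed_compl_basic s)).antisymm fun p hp => ?_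
    · obtain ⟨_, ⟨a, rfl⟩, hpa, haU⟩ :=
        exists_mem_basis_subset isTopologicalBasis_spec_minus hp hU
      exact fun hps => hpa (basic_subset_basic.2 (hs.1 haU) hps)
    · refine (@mem_closure_iff _ (spec B).plus _ _).2 fun V hV hpV => ?_
      obtain ⟨_, ⟨c, rfl⟩, hpc, hcV⟩ :=
        exists_mem_basis_subset isTopologicalBasis_spec_plus hpV hV
      by_contra hne
      refine hp (basic_subset_basic.2 (hs.2 fun a ha => basic_subset_basic.1 fun q hq => ?_) hpc)
      by_contra hqa
      exact hne ⟨q, hcV hq, ha hqa⟩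

end spectrum

/-! ### The duality -/

/-- The functor that takes a bitopological space `X` to the d-lattice `clp X × (clp X)ᵒᵈ`. -/
def clpFunctor : BiTop.{u}ᵒᵖ ⥤ DLat.{u} where
  obj X := DLat.ofLattice X.unop.clp
  map f := DLat.mapOfLattice (BiTop.clpMap f.unop)

theorem clpFunctor_map_bijective {X Y : BiTop.{u}} (hY : Y.IsStone) :
    Function.Bijective (clpFunctor.map : (Opposite.op Y ⟶ Opposite.op X) → _) :=
  ⟨(DLat.mapOfLattice_injective.comp (BiTop.clpMap_injective hY)).comp Quiver.Hom.unop_inj,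
    (DLat.mapOfLattice_surjective.comp (BiTop.clpMap_surjective hY)).comp
      fun f => ⟨f.op, rfl⟩⟩

/-- The d-lattice of a lattice isomorphic to `clp X` is the d-lattice of `X`. -/
def isoClpFunctorObj {B : Type u} [DistribLattice B] [BoundedOrder B] {X : BiTop.{u}}
    (e : B ≃o X.clp) : DLat.ofLattice B ≅ clpFunctor.obj (Opposite.op X) :=
  DLat.isoOfLattice e

theorem nonempty_clpFunctor_spec_iso {L : DLat.{u}} (hL : L.IsDBoolean) :
    Nonempty (clpFunctor.obj (Opposite.op (spec (Set.Iic L.tt))) ≅ L) := by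
  obtain ⟨e⟩ := hL.nonempty_iso
  exact ⟨(isoClpFunctorObj (orderIsoClp (Set.Iic L.tt))).symm ≪≫ e.symm⟩

/-- A functor `F : Cᵒᵖ ⥤ D` that maps `P` into `Q`, is bijective on morphisms between objects
of `P` and hits each object of `Q` up to isomorphism induces a dual equivalence. -/
theorem nonempty_equivalence_of_bijective {C D : Type*} [Category* C] [Category* D] (F : Cᵒᵖ ⥤ D)
    (P : ObjectProperty C) (Q : ObjectProperty D) (hPQ : ∀ X, P X → Q (F.obj (Opposite.op X)))
    (hF : ∀ X Y, P X → P Y →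
      Function.Bijective (F.map : (Opposite.op Y ⟶ Opposite.op X) → _))
    (hQ : ∀ Z, Q Z → ∃ X, P X ∧ Nonempty (F.obj (Opposite.op X) ≅ Z)) :
    Nonempty (Q.FullSubcategoryᵒᵖ ≌ P.FullSubcategory) := by
  let G : P.FullSubcategoryᵒᵖ ⥤ Q.FullSubcategory :=
    Q.lift (P.ι.op ⋙ F) fun X => hPQ _ X.unop.property
  have : G.Faithful := ⟨fun {X Y} f g h => by
    have := (hF _ _ Y.unop.property X.unop.property).1 (congrArg (·.hom) h)
    exact Quiver.Hom.unop_inj (P.ι.map_injective (Quiver.Hom.op_inj this))⟩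
  have : G.Full := ⟨fun {X Y} f => by
    obtain ⟨g, hg⟩ := (hF _ _ Y.unop.property X.unop.property).2 f.hom
    exact ⟨(ObjectProperty.homMk g.unop).op, by ext; exact hg⟩⟩
  have : G.EssSurj := ⟨fun Z => by
    obtain ⟨X, hX, ⟨e⟩⟩ := hQ Z.obj Z.property
    exact ⟨Opposite.op ⟨X, hX⟩, ⟨Q.isoMk e⟩⟩⟩
  have : G.IsEquivalence := {}
  exact ⟨G.asEquivalence.rightOp.symm⟩

end DBoolean

theorem mainTheorem5 :
    Nonempty (DBoolean.CompleteDBool.{u}ᵒᵖ ≌ DBoolean.EDBiStone.{u}) ∧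
      Nonempty (DBoolean.NondegCompleteDBool.{u}ᵒᵖ ≌ DBoolean.NonemptyEDBiStone.{u}) := by
  open DBoolean in
  refine ⟨nonempty_equivalence_of_bijective clpFunctor _ _ (fun X hX => ?_)
      (fun X Y _ hY => clpFunctor_map_bijective hY.1) (fun L hL => ?_),
    nonempty_equivalence_of_bijective clpFunctor _ _ (fun X hX => ?_)
      (fun X Y _ hY => clpFunctor_map_bijective hY.1) (fun L hL => ?_)⟩
  · exact ⟨DLat.isDBoolean_ofLattice, DLat.isComplete_ofLattice hX.2.exists_isLUB⟩
  · exact ⟨_, ⟨isStone_spec, isExtremallyDisconnected_spec hL.2.exists_isLUB_Iic_tt⟩,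
      nonempty_clpFunctor_spec_iso hL.1⟩
  · refine ⟨DLat.isDBoolean_ofLattice, DLat.isComplete_ofLattice hX.2.1.exists_isLUB, ?_⟩
    intro h
    obtain ⟨x⟩ := hX.2.2
    -- As a pair of sets `tt` is `(X, X)`, while `⊤` is `(X, ∅)` and `⊥` is `(∅, X)`; a point `x`
    -- tells them apart.
    have htt : DLat.tt (clpFunctor.obj (Opposite.op X)) ∈ ({⊤, ⊥} : Set _) :=
      h ▸ Set.mem_insert _ _
    obtain h | h := htt
    · have := congrArg (fun z : X.clp × X.clpᵒᵈ => x ∈ (OrderDual.ofDual z.2).1) h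
      exact this.to_iff.1 trivial
    · have := congrArg (fun z : X.clp × X.clpᵒᵈ => x ∈ z.1.1) h
      exact this.to_iff.1 trivial
  · refine ⟨_, ⟨isStone_spec, isExtremallyDisconnected_spec hL.2.1.exists_isLUB_Iic_tt, ?_⟩,
      nonempty_clpFunctor_spec_iso hL.1⟩
    -- The spectrum has a point as soon as `L₊` is nontrivial; `tt = ⊥` would force `ff = ⊤`.
    have htt : ¬ (⊤ : Set.Iic L.tt) ≤ ⊥ := fun h => by
      have htt : L.tt = ⊥ := le_bot_iff.1 h
      have hff : L.ff = ⊤ := by simpa [htt] using L.isCompl_tt_ff.sup_eq_top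
      exact hL.2.2 (by rw [htt, hff, Set.pair_comm])
    obtain ⟨p, -⟩ := exists_boundedLatticeHom_prop htt
    exact ⟨p⟩
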